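/- Call a function $f$ on $]0,\infty[$ completely monotone if it is infinitely differentiable and $(-1)^n f^{(n)}(t)\ge 0$ for all $n\ge 0$, $t>0$; a Bernstein function if it is differentiable, $f\ge 0$ and $f'$ is completely monotone; and a complete Bernstein function if $f(x)=x^2\int_0^\infty e^{-xy}g(y)\,dy$ $(x>0)$ for some Bernstein function $g$. A function $b$ is an admissible dispersion-attenuation function if $b(p)=p\int_{]0,\infty[}\frac{\nu(dr)}{p+r}$ $(p>0)$ for some positive measure $\nu$ on $]0,\infty[$ with $\int_{]0,\infty[}\frac{\nu(dr)}{1+r}<\infty$. The effective exponent of a positive function $b$ is $\alpha_b(p)=\ln b(p)/\ln p$ for $p>0$, $p\ne 1$. (1) Let $a,c>0$, $0\le\alpha<1$ and $b_1(p)=c\,p^\alpha/(a+p^\alpha)$. Then $b_1$ is a complete Bernstein function and $b_1(p)/p\to 0$ as $p\to\infty$. If moreover $\alpha>0$, then $b_1(0)=0=\lim_{p\to 0+}b_1(p)$ and $b_1$ is an admissible dispersion-attenuation function. The effective exponent satisfies $\alpha_{b_1}(p)\to 0$ as $p\to\infty$, and if $c\le 1$ then $\alpha_{b_1}(p)<0$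 for all $p>1$. (2) Let $c,\tau>0$, $0<\beta\le\alpha<1$ and $b_2(p)=c\,(1+\tau p)^{\alpha-\beta}(\tau p)^\beta$. Then $b_2$ is a complete Bernstein function, $b_2(0)=0=\lim_{p\to 0+}b_2(p)$, $b_2(p)/p\to 0$ as $p\to\infty$, and $b_2$ is an admissible dispersion-attenuation function. Its effective exponent moves from $\beta$ at low frequency to $\alpha$ at high frequency: $\alpha_{b_2}(p)\to\beta$ as $p\to 0+$ and $\alpha_{b_2}(p)\to\alpha$ as $p\to\infty$. If $\beta<\alpha$ and $b_2(1)\le 1$, then $\alpha_{b_2}$ is strictly increasing on $]0,1[$ and on $]1,\infty[$; if $\beta<\alpha$ and $b_2(1)=1$, it is strictly increasing on $]0,1[\,\cup\,]1,\infty[$. -/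

import Mathlib

open Set Filter Topology MeasureTheory
open scoped ContDiff

/-- Completely monotone functions on `]0,∞[`: smooth, with `(-1)^n f^(n) ≥ 0` for all `n ≥ 0`. -/
def IsCompletelyMonotone (f : ℝ → ℝ) : Prop :=
  ContDiffOn ℝ ∞ f (Ioi 0) ∧ ∀ (n : ℕ) (t : ℝ), 0 < t → 0 ≤ (-1 : ℝ) ^ n * iteratedDeriv n f t

/-- Bernstein functions on `]0,∞[`: differentiable, non-negative, with a completely monotone
derivative. -/
def IsBernstein (f : ℝ → ℝ) : Prop :=
  DifferentiableOn ℝ f (Ioi 0) ∧ (∀ x : ℝ, 0 < x → 0 ≤ f x) ∧ IsCompletelyMonotone (deriv f)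

/-- Complete Bernstein functions on `]0,∞[`: `f(x) = x² ∫₀^∞ e^{-xy} g(y) dy` for some Bernstein
function `g` (the Laplace integral being convergent). -/
def IsCompleteBernstein (f : ℝ → ℝ) : Prop :=
  ∃ g : ℝ → ℝ, IsBernstein g ∧ ∀ x : ℝ, 0 < x →
    IntegrableOn (fun y : ℝ => Real.exp (-(x * y)) * g y) (Ioi 0) ∧
    f x = x ^ 2 * ∫ y in Ioi (0 : ℝ), Real.exp (-(x * y)) * g y

/-- Admissible dispersion-attenuation functions: `b(p) = p ∫_{]0,∞[} ν(dr) / (p + r)` for a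
positive measure `ν` on `]0,∞[` with `∫_{]0,∞[} ν(dr) / (1 + r) < ∞`. -/
def IsAdmissible (b : ℝ → ℝ) : Prop :=
  ∃ ν : Measure ℝ, ν (Iic 0) = 0 ∧
    IntegrableOn (fun r : ℝ => 1 / (1 + r)) (Ioi 0) ν ∧
    ∀ p : ℝ, 0 < p → b p = p * ∫ r in Ioi (0 : ℝ), 1 / (p + r) ∂ν

/-- The variable (effective) exponent `ln b(p) / ln p`, meaningful for `p > 0`, `p ≠ 1`. -/
noncomputable def effectiveExponent (b : ℝ → ℝ) (p : ℝ) : ℝ :=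
  Real.log (b p) / Real.log p

/-- `b₁(p) = c p^α / (a + p^α)`. -/
noncomputable def bOne (a c α : ℝ) (p : ℝ) : ℝ :=
  c * p ^ α / (a + p ^ α)

/-- `b₂(p) = c (1 + τ p)^(α - β) (τ p)^β`. -/
noncomputable def bTwo (c τ α β : ℝ) (p : ℝ) : ℝ :=
  c * (1 + τ * p) ^ (α - β) * (τ * p) ^ β

/-! The structural claims come from writing each function as p times a Stieltjes integral against a
positive measure. If b(p) = p ∫ ν(dr)/(p+r), then g(y) = ∫ (1 - e^(-ry))/r ν(dr) is Bernstein, since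
g' is the Laplace transform of ν, and 1/(x(x+r)) is the Laplace transform of the kernel; hence
admissible implies complete Bernstein (`IsAdmissible.isCompleteBernstein`). Only b₁ with α = 0, a
constant, needs a separate g, a linear one.

For b₂, rescaling leaves (1+q)^(α-β) q^β = (1+q) · (1+q)^(α-1) · ((1+q)/q)^(-β). Both negative
powers are Stieltjes integrals, and the product of their kernels splits into partial fractions in q
with positive coefficients (`stieltjes_mul_split`).

For b₁, the density is read off on the negative axis by Cauchy's theorem in the variable w = log z,
on the strip 0 ≤ Im w ≤ π. Subtracting 1/(a+p^α) removes the pole at log p, and the integrand is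
real on the lower edge, so the integral over the upper edge has zero imaginary part
(`im_integral_keyholeIntegrand_top`). This gives the integral of the density in terms of
`eulerIntegral`, of which only positivity is ever needed.

For the exponent of b₂, h(s) = log b₂(e^s) is strictly convex and the exponent at e^s is h(s)/s, so
monotonicity is that of secant slopes through s = 0. -/

/-! ### Stieltjes representations and operations on admissible functions -/

/-- A measure carrying an a.e. positive integrable function is σ-finite. -/
theorem sigmaFinite_of_integrable_pos {T : Type*} [MeasurableSpace T] {μ : Measure T} {f : T → ℝ}
    (hf : Integrable f μ) (hpos : ∀ᵐ t ∂μ, 0 < f t) : SigmaFinite μ := by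
  have hF : AEFinStronglyMeasurable f μ := hf.aefinStronglyMeasurable
  have hae : ∀ᵐ t ∂μ, t ∈ hF.sigmaFiniteSet := by
    have h := hF.ae_eq_zero_compl
    rw [Filter.EventuallyEq, ae_restrict_iff' hF.measurableSet.compl] at h
    filter_upwards [h, hpos] with t ht ht0
    by_contra hc
    exact ht0.ne' (ht hc)
  rw [← Measure.restrict_eq_self_of_ae_mem hae]
  infer_instance

/-- A parametrised Stieltjes representation yields an admissible function. -/
theorem isAdmissible_of_integral {T : Type*} [MeasurableSpace T] {μ : Measure T} {w r : T → ℝ}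
    {b : ℝ → ℝ} (hw : Measurable w) (hr : Measurable r) (hw0 : ∀ t, 0 ≤ w t)
    (hr0 : ∀ᵐ t ∂μ, 0 < r t)
    (hint : Integrable (fun t => w t / (1 + r t)) μ)
    (hb : ∀ p : ℝ, 0 < p → b p = p * ∫ t, w t / (p + r t) ∂μ) : IsAdmissible b := by
  set ν := (μ.withDensity fun t => ENNReal.ofReal (w t)).map r with hν
  have hwm : Measurable fun t => ENNReal.ofReal (w t) := hw.ennreal_ofReal
  have hnull : ν (Iic 0) = 0 := by
    rw [hν, Measure.map_apply hr measurableSet_Iic]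
    refine withDensity_absolutelyContinuous _ _ ?_
    have := ae_iff.1 hr0
    simpa [preimage, not_lt] using this
  have hres : ν.restrict (Ioi 0) = ν := by
    refine Measure.restrict_eq_self_of_ae_mem ?_
    rw [ae_iff]
    convert hnull using 2
    ext x; simp
  have hm : ∀ p : ℝ, Measurable fun x : ℝ => 1 / (p + x) := fun p => by fun_prop
  refine ⟨ν, hnull, ?_, fun p hp => ?_⟩
  · rw [IntegrableOn, hres, hν, integrable_map_measure (hm 1).aestronglyMeasurable hr.aemeasurable,
      integrable_withDensity_iff hwm (by simp)]
    refine hint.congr (Eventually.of_forall fun t => ?_)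
    simp [ENNReal.toReal_ofReal (hw0 t), div_eq_mul_inv, mul_comm]
  · rw [hb p hp, hres, hν, integral_map hr.aemeasurable (hm p).aestronglyMeasurable,
      integral_withDensity_eq_integral_toReal_smul hwm (by simp)]
    congr 2
    ext t
    simp [ENNReal.toReal_ofReal (hw0 t), div_eq_mul_inv]

theorem one_div_add_le {p r : ℝ} (hp : 0 < p) (hr : 0 ≤ r) :
    1 / (p + r) ≤ (1 + 1 / p) * (1 / (1 + r)) := by
  have h : 0 < p + r := by linarith
  have h1 : 0 < 1 + r := by linarith
  rw [mul_one_div, div_le_div_iff₀ h h1, one_div]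
  have : p⁻¹ * p = 1 := inv_mul_cancel₀ hp.ne'
  have h2 : 0 ≤ p⁻¹ * r := by positivity
  nlinarith

theorem integrableOn_one_div_add {ν : Measure ℝ}
    (h : IntegrableOn (fun r : ℝ => 1 / (1 + r)) (Ioi 0) ν) {p : ℝ} (hp : 0 < p) :
    IntegrableOn (fun r : ℝ => 1 / (p + r)) (Ioi 0) ν := by
  refine (h.const_mul (1 + 1 / p)).mono'
    (by fun_prop : Measurable fun r : ℝ => 1 / (p + r)).aestronglyMeasurable ?_
  refine (ae_restrict_iff' measurableSet_Ioi).2 (Eventually.of_forall fun r hr => ?_)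
  have hr : 0 < r := hr
  rw [Real.norm_of_nonneg (by positivity)]
  exact one_div_add_le hp hr.le

theorem IsAdmissible.add {b b' : ℝ → ℝ} (h : IsAdmissible b) (h' : IsAdmissible b') :
    IsAdmissible (fun p => b p + b' p) := by
  obtain ⟨ν, h0, hi, hb⟩ := h
  obtain ⟨ν', h0', hi', hb'⟩ := h'
  refine ⟨ν + ν', by simp [h0, h0'], hi.add_measure hi', fun p hp => ?_⟩
  have e := integral_add_measure (integrableOn_one_div_add hi hp) (integrableOn_one_div_add hi' hp)
  beta_reduce
  rw [hb p hp, hb' p hp, Measure.restrict_add, e, mul_add]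

theorem IsAdmissible.congr {b b' : ℝ → ℝ} (h : IsAdmissible b) (hbb : ∀ p, 0 < p → b' p = b p) :
    IsAdmissible b' := by
  obtain ⟨ν, h0, hi, hb⟩ := h
  exact ⟨ν, h0, hi, fun p hp => (hbb p hp).trans (hb p hp)⟩

/-- Since τp/(τp + r) = p/(p + r/τ), the new measure is c times the image of ν under r ↦ r/τ. -/
theorem IsAdmissible.const_mul_comp_mul {b : ℝ → ℝ} (h : IsAdmissible b) {c τ : ℝ} (hc : 0 ≤ c)
    (hτ : 0 < τ) : IsAdmissible (fun p => c * b (τ * p)) := by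
  obtain ⟨ν, h0, hi, hb⟩ := h
  refine isAdmissible_of_integral (μ := ν.restrict (Ioi 0)) (w := fun _ => c)
    (r := fun t => t / τ) measurable_const (by fun_prop) (fun _ => hc)
    ((ae_restrict_iff' measurableSet_Ioi).2 (Eventually.of_forall fun r hr => div_pos hr hτ))
    ?_ fun p hp => ?_
  · refine ((integrableOn_one_div_add hi hτ).const_mul (c * τ)).congr
      ((ae_restrict_iff' measurableSet_Ioi).2 (Eventually.of_forall fun r hr => ?_))
    have hr : 0 < r := hr
    have : 0 < τ + r := by positivity
    simp only
    field_simp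
  · rw [hb _ (mul_pos hτ hp), ← integral_const_mul, ← integral_const_mul, ← integral_const_mul]
    refine setIntegral_congr_fun measurableSet_Ioi fun r hr => ?_
    have hr : 0 < r := hr
    have : 0 < τ * p + r := by positivity
    field_simp

/-! ### Admissible functions are complete Bernstein -/

/-- From e^u ≥ 1 + u with u = ry; the bound is written as a Stieltjes kernel at p = 1/y so that
admissibility gives integrability. -/
theorem exp_neg_mul_le {r y : ℝ} (hr : 0 < r) (hy : 0 < y) :
    Real.exp (-(r * y)) ≤ y⁻¹ * (1 / (y⁻¹ + r)) := by
  have h1 : r * y + 1 ≤ Real.exp (r * y) := Real.add_one_le_exp _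
  have h : y⁻¹ * (1 / (y⁻¹ + r)) = (r * y + 1)⁻¹ := by field_simp; ring
  rw [h, Real.exp_neg]
  exact inv_anti₀ (by positivity) h1

theorem one_sub_exp_neg_mul_div_nonneg {r y : ℝ} (hr : 0 < r) (hy : 0 ≤ y) :
    0 ≤ (1 - Real.exp (-(r * y))) / r := by
  have : Real.exp (-(r * y)) ≤ 1 := Real.exp_le_one_iff.2 (by nlinarith)
  exact div_nonneg (by linarith) hr.le

/-- With u = ry, 1 - e^(-u) ≤ min(1, u) ≤ 2u/(1+u). -/
theorem one_sub_exp_neg_mul_div_le {r y : ℝ} (hr : 0 < r) (hy : 0 < y) :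
    (1 - Real.exp (-(r * y))) / r ≤ 2 * (1 / (y⁻¹ + r)) := by
  have h1 : -(r * y) + 1 ≤ Real.exp (-(r * y)) := Real.add_one_le_exp _
  have h0 := Real.exp_pos (-(r * y))
  have hu : 0 < r * y := mul_pos hr hy
  have h : 2 * (1 / (y⁻¹ + r)) = 2 * (r * y) / (1 + r * y) / r := by field_simp
  rw [h]
  refine div_le_div_of_nonneg_right ?_ hr.le
  rw [le_div_iff₀ (by positivity)]
  rcases le_total (r * y) 1 with h2 | h2 <;> nlinarith

section Laplace

variable {μ : Measure ℝ} (hpos : ∀ᵐ r ∂μ, 0 < r)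
  (hint : ∀ p : ℝ, 0 < p → Integrable (fun r : ℝ => 1 / (p + r)) μ)
include hpos hint

theorem integrable_exp_neg_mul_of_stieltjes {y : ℝ} (hy : 0 < y) :
    Integrable (fun r : ℝ => Real.exp (-(r * y))) μ := by
  refine ((hint y⁻¹ (inv_pos.2 hy)).const_mul y⁻¹).mono'
    (by fun_prop : Measurable fun r : ℝ => Real.exp (-(r * y))).aestronglyMeasurable ?_
  filter_upwards [hpos] with r hr
  rw [Real.norm_of_nonneg (Real.exp_pos _).le]
  exact exp_neg_mul_le hr hy

theorem integrable_one_sub_exp_neg_mul_div {y : ℝ} (hy : 0 < y) :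
    Integrable (fun r : ℝ => (1 - Real.exp (-(r * y))) / r) μ := by
  refine ((hint y⁻¹ (inv_pos.2 hy)).const_mul 2).mono'
    (by fun_prop : Measurable fun r : ℝ => (1 - Real.exp (-(r * y))) / r).aestronglyMeasurable ?_
  filter_upwards [hpos] with r hr
  rw [Real.norm_of_nonneg (one_sub_exp_neg_mul_div_nonneg hr hy.le)]
  exact one_sub_exp_neg_mul_div_le hr hy

theorem hasDerivAt_integral_one_sub_exp {y : ℝ} (hy : 0 < y) :
    HasDerivAt (fun y => ∫ r, (1 - Real.exp (-(r * y))) / r ∂μ)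
      (ProbabilityTheory.mgf id μ (-y)) y := by
  have hy2 : 0 < y / 2 := by positivity
  -- Near y one may keep x > y/2, where e^(-rx) is dominated by e^(-ry/2).
  have h := (hasDerivAt_integral_of_dominated_loc_of_deriv_le (μ := μ)
    (F := fun y r => (1 - Real.exp (-(r * y))) / r) (F' := fun y r => Real.exp (-(r * y)))
    (bound := fun r => Real.exp (-(r * (y / 2)))) (Ioi_mem_nhds (half_lt_self hy))
    (Eventually.of_forall fun x => (by fun_prop :
      Measurable fun r : ℝ => (1 - Real.exp (-(r * x))) / r).aestronglyMeasurable)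
    (integrable_one_sub_exp_neg_mul_div hpos hint hy)
    (by fun_prop : Measurable fun r : ℝ => Real.exp (-(r * y))).aestronglyMeasurable
    (by
      filter_upwards [hpos] with r hr x hx
      have hx : y / 2 < x := hx
      rw [Real.norm_of_nonneg (Real.exp_pos _).le, Real.exp_le_exp]
      nlinarith)
    (integrable_exp_neg_mul_of_stieltjes hpos hint hy2)
    (by
      filter_upwards [hpos] with r hr x hx
      have h1 : HasDerivAt (fun x : ℝ => -(r * x)) (-r) x := by
        simpa using (hasDerivAt_id x).const_mul (-r)
      refine ((h1.exp.const_sub 1).div_const r).congr_deriv ?_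
      field_simp)).2
  refine h.congr_deriv (integral_congr_ae (Eventually.of_forall fun r => ?_))
  simp [mul_comm]

/-- The Laplace transform of μ at y is its moment generating function at -y; this places -y where
the latter is analytic and may be differentiated under the integral. -/
theorem neg_mem_interior_integrableExpSet {y : ℝ} (hy : 0 < y) :
    -y ∈ interior (ProbabilityTheory.integrableExpSet id μ) := by
  refine mem_interior.2 ⟨Iio 0, fun t ht => ?_, isOpen_Iio, by simpa using hy⟩
  have ht : t < 0 := ht
  refine (integrable_exp_neg_mul_of_stieltjes hpos hint (neg_pos.2 ht)).congr
    (Eventually.of_forall fun r => ?_)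
  simp [mul_comm]

theorem isBernstein_integral_one_sub_exp :
    IsBernstein (fun y => ∫ r, (1 - Real.exp (-(r * y))) / r ∂μ) := by
  have hd := fun y (hy : 0 < y) => hasDerivAt_integral_one_sub_exp hpos hint hy
  have heq : ∀ t : ℝ, 0 < t → deriv (fun y => ∫ r, (1 - Real.exp (-(r * y))) / r ∂μ) =ᶠ[𝓝 t]
      fun y => ProbabilityTheory.mgf id μ (-y) := fun t ht => by
    filter_upwards [Ioi_mem_nhds ht] with y hy using (hd y hy).deriv
  refine ⟨fun y hy => (hd y hy).differentiableAt.differentiableWithinAt, fun y hy => ?_, ?_, ?_⟩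
  · refine integral_nonneg_of_ae ?_
    filter_upwards [hpos] with r hr using one_sub_exp_neg_mul_div_nonneg hr hy.le
  · intro t ht
    refine (ContDiffAt.congr_of_eventuallyEq ?_ (heq t ht)).contDiffWithinAt
    exact (ProbabilityTheory.analyticAt_mgf
      (neg_mem_interior_integrableExpSet hpos hint ht)).contDiffAt.comp t contDiffAt_id.neg
  · intro n t ht
    -- The reflection y ↦ -y yields a factor (-1)^n that cancels the sign in complete monotonicity,
    -- leaving ∫ r^n e^(-tr) dμ.
    rw [(heq t ht).iteratedDeriv_eq n, iteratedDeriv_comp_neg,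
      ProbabilityTheory.iteratedDeriv_mgf (neg_mem_interior_integrableExpSet hpos hint ht),
      smul_eq_mul, ← mul_assoc, ← mul_pow]
    simp only [mul_neg, mul_one, neg_neg, one_pow, one_mul]
    refine integral_nonneg_of_ae ?_
    filter_upwards [hpos] with r hr
    have : 0 < r := hr
    simp only [id, Pi.zero_apply]
    positivity

end Laplace

theorem laplace_one_sub_exp {x r : ℝ} (hx : 0 < x) (hr : 0 < r) :
    IntegrableOn (fun y => Real.exp (-(x * y)) * ((1 - Real.exp (-(r * y))) / r)) (Ioi 0) ∧
    ∫ y in Ioi (0 : ℝ), Real.exp (-(x * y)) * ((1 - Real.exp (-(r * y))) / r) =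
      1 / x * (1 / (x + r)) := by
  have hxr : 0 < x + r := by positivity
  have e : (fun y => Real.exp (-(x * y)) * ((1 - Real.exp (-(r * y))) / r)) =
      fun y => r⁻¹ * (Real.exp (-x * y) - Real.exp (-(x + r) * y)) := by
    ext y
    rw [show -(x + r) * y = -(x * y) + -(r * y) by ring, Real.exp_add, neg_mul]
    ring
  have i1 := integrableOn_exp_mul_Ioi (neg_lt_zero.2 hx) 0
  have i2 := integrableOn_exp_mul_Ioi (neg_lt_zero.2 hxr) 0
  rw [e]
  refine ⟨(i1.sub i2).const_mul _, ?_⟩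
  rw [integral_const_mul, integral_sub i1 i2, integral_exp_mul_Ioi (neg_lt_zero.2 hx),
    integral_exp_mul_Ioi (neg_lt_zero.2 hxr)]
  simp only [mul_zero, Real.exp_zero]
  field_simp
  ring

/-- Every admissible function is a complete Bernstein function. -/
theorem IsAdmissible.isCompleteBernstein {b : ℝ → ℝ} (h : IsAdmissible b) :
    IsCompleteBernstein b := by
  obtain ⟨ν, -, hi, hb⟩ := h
  set μ := ν.restrict (Ioi 0) with hμ
  have hpos : ∀ᵐ r ∂μ, 0 < r := ae_restrict_mem measurableSet_Ioi
  have hint : ∀ p : ℝ, 0 < p → Integrable (fun r : ℝ => 1 / (p + r)) μ :=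
    fun p hp => integrableOn_one_div_add hi hp
  -- ν is an arbitrary measure, and Fubini needs σ-finiteness.
  have : SigmaFinite μ := sigmaFinite_of_integrable_pos (hint 1 one_pos)
    (by filter_upwards [hpos] with r hr; positivity)
  refine ⟨_, isBernstein_integral_one_sub_exp hpos hint, fun x hx => ?_⟩
  have hF : Integrable (Function.uncurry fun y r : ℝ =>
      Real.exp (-(x * y)) * ((1 - Real.exp (-(r * y))) / r))
      ((volume.restrict (Ioi 0)).prod μ) := by
    rw [integrable_prod_iff' (by
      simp only [Function.uncurry_def]
      exact Measurable.aestronglyMeasurable (by fun_prop))]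
    refine ⟨?_, ((hint x hx).const_mul (1 / x)).congr ?_⟩
    · filter_upwards [hpos] with r hr using (laplace_one_sub_exp hx hr).1
    · filter_upwards [hpos] with r hr
      rw [← (laplace_one_sub_exp hx hr).2]
      refine setIntegral_congr_fun measurableSet_Ioi fun y hy => ?_
      have h0 := one_sub_exp_neg_mul_div_nonneg hr (le_of_lt hy)
      exact (Real.norm_of_nonneg (mul_nonneg (Real.exp_pos _).le h0)).symm
  constructor
  · refine hF.integral_prod_left.congr (Eventually.of_forall fun y => ?_)
    simp only [Function.uncurry]
    exact integral_const_mul _ _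
  · have e : ∫ y in Ioi (0 : ℝ), Real.exp (-(x * y)) * ∫ r, (1 - Real.exp (-(r * y))) / r ∂μ =
        ∫ r, 1 / x * (1 / (x + r)) ∂μ := by
      simp_rw [← integral_const_mul (Real.exp _)]
      rw [integral_integral_swap hF]
      refine integral_congr_ae ?_
      filter_upwards [hpos] with r hr using (laplace_one_sub_exp hx hr).2
    rw [e, integral_const_mul, hb x hx]
    field_simp

/-- Take g(y) = ky, because ∫ y e^(-xy) dy = 1/x². -/
theorem isCompleteBernstein_const {f : ℝ → ℝ} {k : ℝ} (hk : 0 ≤ k) (hf : ∀ x, 0 < x → f x = k) :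
    IsCompleteBernstein f := by
  have hd : deriv (fun y : ℝ => k * y) = fun _ => k := by
    ext y
    simp
  refine ⟨fun y => k * y, ⟨by fun_prop, fun x hx => by positivity, ?_, ?_⟩, fun x hx => ?_⟩
  · rw [hd]; fun_prop
  · intro n t ht
    rw [hd, iteratedDeriv_const]
    split_ifs with h
    · simp [h, hk]
    · simp
  · have h := Real.integral_rpow_mul_exp_neg_mul_Ioi (a := 2) (r := x) two_pos hx
    have e : (fun t : ℝ => t ^ ((2 : ℝ) - 1) * Real.exp (-(x * t))) =
        fun t => t * Real.exp (-(x * t)) := by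
      ext t; norm_num
    rw [e] at h
    norm_num at h
    have hI : IntegrableOn (fun t => t * Real.exp (-(x * t))) (Ioi 0) := by
      -- A non-integrable function has integral 0 by convention, whereas the value here is nonzero.
      by_contra hc
      rw [integral_undef hc] at h
      have : (x ^ 2)⁻¹ ≠ 0 := by positivity
      exact this h.symm
    have e2 : (fun y => Real.exp (-(x * y)) * (k * y)) = fun y => k * (y * Real.exp (-(x * y))) := by
      ext y; ring
    rw [e2]
    refine ⟨hI.const_mul k, ?_⟩
    rw [integral_const_mul, h, hf x hx]
    field_simp

/-! ### Euler integrals and the Stieltjes representation of b₂ -/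

theorem integrable_exp_mul_div_add_exp {s p : ℝ} (hs : 0 < s) (hs1 : s < 1) (hp : 0 < p) :
    Integrable (fun t : ℝ => Real.exp (s * t) / (p + Real.exp t)) := by
  have hm : Measurable fun t : ℝ => Real.exp (s * t) / (p + Real.exp t) := by fun_prop
  rw [← integrableOn_univ, ← Iic_union_Ioi (a := (0 : ℝ))]
  refine IntegrableOn.union ?_ ?_
  · refine ((integrableOn_exp_mul_Iic hs 0).const_mul p⁻¹).mono' hm.aestronglyMeasurable
      (Eventually.of_forall fun t => ?_)
    rw [Real.norm_of_nonneg (by positivity), div_eq_inv_mul]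
    gcongr
    linarith [Real.exp_pos t]
  · refine (integrableOn_exp_mul_Ioi (sub_neg.2 hs1) 0).mono' hm.aestronglyMeasurable
      (Eventually.of_forall fun t => ?_)
    rw [Real.norm_of_nonneg (by positivity), sub_mul, one_mul, Real.exp_sub]
    gcongr
    linarith [Real.exp_pos t]

/-- The integral `∫ r^(s-1) / (1 + r) dr` over the half line, in exponential coordinates. -/
noncomputable def eulerIntegral (s : ℝ) : ℝ := ∫ t : ℝ, Real.exp (s * t) / (1 + Real.exp t)

theorem eulerIntegral_pos {s : ℝ} (hs : 0 < s) (hs1 : s < 1) : 0 < eulerIntegral s := by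
  have hpos : ∀ t : ℝ, 0 < Real.exp (s * t) / (1 + Real.exp t) := fun t => by positivity
  have hsupp : Function.support (fun t : ℝ => Real.exp (s * t) / (1 + Real.exp t)) = univ :=
    eq_univ_of_forall fun t => (hpos t).ne'
  rw [eulerIntegral, integral_pos_iff_support_of_nonneg (fun t => (hpos t).le)
    (integrable_exp_mul_div_add_exp hs hs1 one_pos), hsupp]
  simp

/-- Homogeneity: translate t by log p. -/
theorem integral_exp_mul_div_add_exp (s : ℝ) {p : ℝ} (hp : 0 < p) :
    ∫ t : ℝ, Real.exp (s * t) / (p + Real.exp t) = p ^ (s - 1) * eulerIntegral s := by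
  rw [← integral_add_right_eq_self _ (Real.log p), eulerIntegral, ← integral_const_mul]
  congr 1
  ext t
  rw [mul_add, Real.exp_add, Real.exp_add, Real.exp_log hp, Real.rpow_sub hp, Real.rpow_one,
    Real.rpow_def_of_pos hp, mul_comm (Real.log p)]
  have : 0 < 1 + Real.exp t := by positivity
  have : 0 < p + Real.exp t * p := by positivity
  field_simp

/-- The right side is (1+q)/((1+q+E)(1+q+qU)); the left is its partial fraction decomposition, with
poles at q = -1/(1+U) and q = -(1+E). -/
theorem stieltjes_mul_split {q E U : ℝ} (hq : 0 < q) (hE : 0 < E) (hU : 0 < U) :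
    U / ((1 + U) * (U + E + U * E)) / (q + 1 / (1 + U)) + E / (U + E + U * E) / (q + (1 + E)) =
      (1 + q) / q * (1 / (1 + q + E) * (1 / ((1 + q) / q + U))) := by
  have : 0 < q * (1 + U) + 1 := by positivity
  have : 0 < 1 + q + q * U := by positivity
  have : 0 < U + E + U * E := by positivity
  field_simp
  ring

theorem isAdmissible_one_add_rpow_mul_rpow {α β : ℝ} (hβ : 0 < β) (hβα : β ≤ α) (hα : α < 1) :
    IsAdmissible (fun q => (1 + q) ^ (α - β) * q ^ β) := by
  have hα0 : 0 < α := hβ.trans_le hβα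
  have hδ0 : 0 < 1 - β := by linarith
  have hδ1 : 1 - β < 1 := by linarith
  set k := (eulerIntegral α * eulerIntegral (1 - β))⁻¹ with hk
  have hKα := eulerIntegral_pos hα0 hα
  have hKδ := eulerIntegral_pos hδ0 hδ1
  have hk0 : 0 < k := by positivity
  let c : ℝ × ℝ → ℝ := fun x => k * (Real.exp (α * x.1) * Real.exp ((1 - β) * x.2))
  let D : ℝ × ℝ → ℝ := fun x => Real.exp x.2 + Real.exp x.1 + Real.exp x.2 * Real.exp x.1
  let w₁ : ℝ × ℝ → ℝ := fun x => c x * (Real.exp x.2 / ((1 + Real.exp x.2) * D x))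
  let w₂ : ℝ × ℝ → ℝ := fun x => c x * (Real.exp x.1 / D x)
  let r₁ : ℝ × ℝ → ℝ := fun x => 1 / (1 + Real.exp x.2)
  let r₂ : ℝ × ℝ → ℝ := fun x => 1 + Real.exp x.1
  have hw₁ : ∀ x, 0 ≤ w₁ x := fun x => by positivity
  have hw₂ : ∀ x, 0 ≤ w₂ x := fun x => by positivity
  have hr₁ : ∀ x, 0 < r₁ x := fun x => by positivity
  have hr₂ : ∀ x, 0 < r₂ x := fun x => by positivity
  have mw₁ : Measurable w₁ := by fun_prop
  have mw₂ : Measurable w₂ := by fun_prop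
  have mr₁ : Measurable r₁ := by fun_prop
  have mr₂ : Measurable r₂ := by fun_prop
  let F : ℝ → ℝ × ℝ → ℝ := fun q x => k * ((1 + q) / q) *
    (Real.exp (α * x.1) / (1 + q + Real.exp x.1) *
      (Real.exp ((1 - β) * x.2) / ((1 + q) / q + Real.exp x.2)))
  have hF : ∀ q, 0 < q → Integrable (F q) := fun q hq =>
    ((integrable_exp_mul_div_add_exp hα0 hα (by positivity)).mul_prod
      (integrable_exp_mul_div_add_exp hδ0 hδ1 (by positivity))).const_mul _
  have hsum : ∀ q, 0 < q → ∀ x, w₁ x / (q + r₁ x) + w₂ x / (q + r₂ x) = F q x := by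
    intro q hq x
    have h := stieltjes_mul_split hq (Real.exp_pos x.1) (Real.exp_pos x.2)
    simp only [w₁, w₂, r₁, r₂, F, D]
    rw [mul_div_assoc, mul_div_assoc, ← mul_add, h]
    simp only [c]
    ring
  -- Both summands are nonnegative, so each is dominated by their integrable sum `F q`.
  have i₁ : ∀ q, 0 < q → Integrable (fun x => w₁ x / (q + r₁ x)) := fun q hq => by
    refine (hF q hq).mono' (Measurable.aestronglyMeasurable (by fun_prop))
      (Eventually.of_forall fun x => ?_)
    have h1 := hw₁ x; have h2 := hw₂ x; have h3 := hr₁ x; have h4 := hr₂ x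
    rw [← hsum q hq, Real.norm_of_nonneg (by positivity)]
    exact le_add_of_nonneg_right (by positivity)
  have i₂ : ∀ q, 0 < q → Integrable (fun x => w₂ x / (q + r₂ x)) := fun q hq => by
    refine (hF q hq).mono' (Measurable.aestronglyMeasurable (by fun_prop))
      (Eventually.of_forall fun x => ?_)
    have h1 := hw₁ x; have h2 := hw₂ x; have h3 := hr₁ x; have h4 := hr₂ x
    rw [← hsum q hq, Real.norm_of_nonneg (by positivity)]
    exact le_add_of_nonneg_left (by positivity)
  have a₁ : IsAdmissible fun q => q * ∫ x, w₁ x / (q + r₁ x) :=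
    isAdmissible_of_integral mw₁ mr₁ hw₁ (Eventually.of_forall hr₁) (i₁ 1 one_pos) fun _ _ => rfl
  have a₂ : IsAdmissible fun q => q * ∫ x, w₂ x / (q + r₂ x) :=
    isAdmissible_of_integral mw₂ mr₂ hw₂ (Eventually.of_forall hr₂) (i₂ 1 one_pos) fun _ _ => rfl
  refine (a₁.add a₂).congr fun q hq => ?_
  have e : ∫ x, w₁ x / (q + r₁ x) + w₂ x / (q + r₂ x) = ∫ x, F q x :=
    integral_congr_ae (Eventually.of_forall (hsum q hq))
  have hq1 : 0 < 1 + q := by positivity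
  have hz : 0 < (1 + q) / q := by positivity
  rw [← mul_add, ← integral_add (i₁ q hq) (i₂ q hq), e, integral_const_mul,
    Measure.volume_eq_prod,
    integral_prod_mul (fun t => Real.exp (α * t) / (1 + q + Real.exp t))
      (fun u => Real.exp ((1 - β) * u) / ((1 + q) / q + Real.exp u)),
    integral_exp_mul_div_add_exp _ hq1, integral_exp_mul_div_add_exp _ hz]
  have e1 : q * (k * ((1 + q) / q) * ((1 + q) ^ (α - 1) * eulerIntegral α *
      (((1 + q) / q) ^ (1 - β - 1) * eulerIntegral (1 - β)))) =
      (1 + q) * (1 + q) ^ (α - 1) * ((1 + q) / q) ^ (-β) := by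
    rw [hk, show 1 - β - 1 = -β by ring]
    field_simp
  rw [e1, Real.div_rpow hq1.le hq.le, Real.rpow_neg hq.le, Real.rpow_neg hq1.le,
    Real.rpow_sub hq1, Real.rpow_sub hq1, Real.rpow_one]
  field_simp

/-! ### Contour integration and the Stieltjes representation of b₁ -/

theorem normSq_add_exp (a α x y : ℝ) :
    Complex.normSq (a + Complex.exp (α * (x + y * Complex.I))) =
      a ^ 2 + 2 * a * Real.exp (α * x) * Real.cos (α * y) + Real.exp (α * x) ^ 2 := by
  have hre : (α * (x + y * Complex.I) : ℂ).re = α * x := by simp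
  have him : (α * (x + y * Complex.I) : ℂ).im = α * y := by simp
  rw [Complex.normSq_apply, Complex.add_re, Complex.add_im, Complex.exp_re, Complex.exp_im, hre,
    him, Complex.ofReal_re, Complex.ofReal_im]
  linear_combination Real.exp (α * x) ^ 2 * Real.sin_sq_add_cos_sq (α * y)

/-- Cosine decreases on [0, π], so cos(αy) ≥ -|cos(απ)|; then 2ae ≤ a² + e² with e = e^(αx) gives
the bound (1 - |cos(απ)|)(a² + e²), uniform in x and y. -/
theorem le_normSq_add_exp {a α y : ℝ} (ha : 0 < a) (hα : 0 < α) (hα1 : α < 1) (x : ℝ)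
    (hy : 0 ≤ y) (hyπ : y ≤ Real.pi) :
    (1 - |Real.cos (α * Real.pi)|) * a ^ 2 ≤
      Complex.normSq (a + Complex.exp (α * (x + y * Complex.I))) := by
  rw [normSq_add_exp]
  have hπ := Real.pi_pos
  have hcos : Real.cos (α * Real.pi) ≤ Real.cos (α * y) :=
    Real.cos_le_cos_of_nonneg_of_le_pi (by positivity) (by nlinarith) (by gcongr)
  have hc1 := neg_abs_le (Real.cos (α * Real.pi))
  have hc2 := Real.abs_cos_le_one (α * Real.pi)
  set e := Real.exp (α * x)
  have he : 0 < e := Real.exp_pos _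
  have h1 : -|Real.cos (α * Real.pi)| * (2 * a * e) ≤ Real.cos (α * y) * (2 * a * e) := by
    gcongr; linarith
  nlinarith [mul_nonneg (abs_nonneg (Real.cos (α * Real.pi))) (sq_nonneg (a - e)),
    mul_nonneg (sub_nonneg.2 hc2) (sq_nonneg e)]

theorem abs_cos_mul_pi_lt_one {α : ℝ} (hα : 0 < α) (hα1 : α < 1) :
    |Real.cos (α * Real.pi)| < 1 := by
  have hπ := Real.pi_pos
  have hs : 0 < Real.sin (α * Real.pi) := Real.sin_pos_of_pos_of_lt_pi (by positivity) (by nlinarith)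
  rw [← sq_lt_one_iff_abs_lt_one]
  nlinarith [Real.sin_sq_add_cos_sq (α * Real.pi)]

/-- A neighbourhood of the closed strip `0 ≤ Im w ≤ π` on which `e^w` is injective around the real
axis and `a + e^(α w)` does not vanish. -/
def keyholeStrip (α : ℝ) : Set ℂ := {w | |α * w.im| < Real.pi ∧ |w.im| < 2 * Real.pi}

theorem isOpen_keyholeStrip (α : ℝ) : IsOpen (keyholeStrip α) :=
  (isOpen_lt (f := fun w : ℂ => |α * w.im|) (continuous_const.mul Complex.continuous_im).abs
    continuous_const).inter
    (isOpen_lt (f := fun w : ℂ => |w.im|) Complex.continuous_im.abs continuous_const)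

theorem add_exp_ne_zero_of_mem_keyholeStrip {a α : ℝ} (ha : 0 < a) {w : ℂ}
    (hw : w ∈ keyholeStrip α) : (a : ℂ) + Complex.exp (α * w) ≠ 0 := by
  intro h
  have hre := congrArg Complex.re h
  have him := congrArg Complex.im h
  rw [Complex.add_re, Complex.exp_re] at hre
  rw [Complex.add_im, Complex.exp_im] at him
  simp at hre him
  have h1 := abs_lt.1 hw.1
  have h0 := (Real.sin_eq_zero_iff_of_lt_of_lt h1.1 h1.2).1 him
  rw [h0, Real.cos_zero] at hre
  have := Real.exp_pos (α * w.re)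
  linarith

theorem exp_ne_of_mem_keyholeStrip {α p : ℝ} (hp : 0 < p) {w : ℂ} (hw : w ∈ keyholeStrip α)
    (hne : w ≠ (Real.log p : ℂ)) : Complex.exp w ≠ p := by
  intro h
  have h2 := abs_lt.1 hw.2
  have hπ := Real.pi_pos
  have hlog : Complex.exp w = Complex.exp (Real.log p : ℂ) := by
    rw [h, ← Complex.ofReal_exp, Real.exp_log hp]
  obtain ⟨n, hn⟩ := Complex.exp_eq_exp_iff_exists_int.1 hlog
  have him : w.im = n * (2 * Real.pi) := by simpa using congrArg Complex.im hn
  rw [him] at h2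
  have hn1 : (-1 : ℝ) < n := by nlinarith
  have hn2 : (n : ℝ) < 1 := by nlinarith
  have hn0 : n = 0 := by
    have h3 : (-1 : ℤ) < n := by exact_mod_cast hn1
    have h4 : n < (1 : ℤ) := by exact_mod_cast hn2
    omega
  apply hne
  simpa [hn0] using hn

/-- The integrand of the keyhole contour, with its singularity at `log p` removed. -/
noncomputable def keyholeIntegrand (a α p : ℝ) (w : ℂ) : ℂ :=
  Complex.exp (α * w) *
    (dslope (fun w : ℂ => 1 / ((a : ℂ) + Complex.exp (α * w))) (Real.log p) w /
      dslope Complex.exp (Real.log p) w)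

/-- The factor w - log p common to the two difference quotients cancels. -/
theorem keyholeIntegrand_eq {a α p : ℝ} (hp : 0 < p) {w : ℂ} (hne : w ≠ (Real.log p : ℂ)) :
    keyholeIntegrand a α p w = Complex.exp (α * w) *
      (1 / ((a : ℂ) + Complex.exp (α * w)) - (1 / (a + p ^ α) : ℝ)) / (Complex.exp w - p) := by
  have h1 : Complex.exp (Real.log p : ℂ) = p := by
    rw [← Complex.ofReal_exp, Real.exp_log hp]
  have h2 : Complex.exp (α * (Real.log p : ℂ)) = (p ^ α : ℝ) := by
    rw [Real.rpow_def_of_pos hp, Complex.ofReal_exp, Complex.ofReal_mul, mul_comm]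
  have h3 : w - (Real.log p : ℂ) ≠ 0 := sub_ne_zero.2 hne
  rw [keyholeIntegrand, dslope_of_ne _ hne, dslope_of_ne _ hne, slope_def_field, slope_def_field,
    h1, h2, div_div_div_cancel_right₀ h3, mul_div_assoc]
  push_cast
  rfl

/-- Difference quotients of holomorphic functions extend holomorphically, and that of exp has no
zero on the strip: its value at log p is p, and elsewhere e^w ≠ p. -/
theorem differentiableOn_keyholeIntegrand {a α p : ℝ} (ha : 0 < a) (hp : 0 < p) :
    DifferentiableOn ℂ (keyholeIntegrand a α p) (keyholeStrip α) := by
  have hmem : (Real.log p : ℂ) ∈ keyholeStrip α := by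
    simp [keyholeStrip, Real.pi_pos]
  have hnhds := (isOpen_keyholeStrip α).mem_nhds hmem
  refine DifferentiableOn.mul (by fun_prop) (DifferentiableOn.div ?_ ?_ ?_)
  · refine (Complex.differentiableOn_dslope hnhds).2 ?_
    exact DifferentiableOn.div (by fun_prop) (by fun_prop)
      fun w hw => add_exp_ne_zero_of_mem_keyholeStrip ha hw
  · exact (Complex.differentiableOn_dslope hnhds).2 (by fun_prop)
  · intro w hw
    by_cases hne : w = (Real.log p : ℂ)
    · rw [hne, dslope_same, Complex.deriv_exp]
      exact Complex.exp_ne_zero _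
    · rw [dslope_of_ne _ hne, slope_def_field]
      refine div_ne_zero (sub_ne_zero.2 ?_) (sub_ne_zero.2 hne)
      rw [← Complex.ofReal_exp, Real.exp_log hp]
      exact exp_ne_of_mem_keyholeStrip hp hw hne

theorem exists_norm_keyholeIntegrand_le {a α p : ℝ} (ha : 0 < a) (hα : 0 < α) (hα1 : α < 1)
    (hp : 0 < p) : ∃ C : ℝ, 0 < C ∧ ∀ x y : ℝ, 0 ≤ y → y ≤ Real.pi →
      (x + y * Complex.I : ℂ) ≠ (Real.log p : ℂ) →
      ‖keyholeIntegrand a α p (x + y * Complex.I)‖ ≤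
        C * Real.exp (α * x) / ‖Complex.exp (x + y * Complex.I) - p‖ := by
  have hc := abs_cos_mul_pi_lt_one hα hα1
  set m := Real.sqrt ((1 - |Real.cos (α * Real.pi)|) * a ^ 2) with hm
  have hm0 : 0 < m := Real.sqrt_pos.2 (mul_pos (sub_pos.2 hc) (by positivity))
  have hl : 0 < 1 / (a + p ^ α) := by positivity
  refine ⟨1 / m + 1 / (a + p ^ α), by positivity, fun x y hy hyπ hne => ?_⟩
  rw [keyholeIntegrand_eq hp hne, norm_div, norm_mul, Complex.norm_exp, mul_comm]
  have hre : (α * (x + y * Complex.I) : ℂ).re = α * x := by simp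
  rw [hre]
  gcongr
  refine (norm_sub_le _ _).trans ?_
  rw [Complex.norm_real, Real.norm_of_nonneg hl.le, norm_div, norm_one]
  gcongr
  rw [Complex.norm_def]
  exact Real.sqrt_le_sqrt (le_normSq_add_exp ha hα hα1 x hy hyπ)

theorem mem_keyholeStrip {α : ℝ} (hα : 0 < α) (hα1 : α < 1) {w : ℂ} (h0 : 0 ≤ w.im)
    (hπ : w.im ≤ Real.pi) : w ∈ keyholeStrip α := by
  have := Real.pi_pos
  refine ⟨?_, ?_⟩
  · rw [abs_of_nonneg (by positivity)]; nlinarith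
  · rw [abs_of_nonneg h0]; linarith

theorem im_integral_keyholeIntegrand_real {a α p : ℝ} (hp : 0 < p) (R : ℝ) :
    (∫ x : ℝ in (-R)..R, keyholeIntegrand a α p x).im = 0 := by
  have h : ∀ᵐ x : ℝ, x ∈ uIoc (-R) R → keyholeIntegrand a α p x =
      ((Real.exp (α * x) * (1 / (a + Real.exp (α * x)) - 1 / (a + p ^ α)) /
        (Real.exp x - p) : ℝ) : ℂ) := by
    -- The real-valued formula fails at most at x = log p, a null set.
    have : ∀ᵐ x : ℝ, x ≠ Real.log p := by simp [ae_iff]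
    filter_upwards [this] with x hx _
    rw [keyholeIntegrand_eq hp (by exact_mod_cast hx)]
    push_cast
    rfl
  rw [intervalIntegral.integral_congr_ae h, intervalIntegral.integral_ofReal, Complex.ofReal_im]

theorem tendsto_integral_side {a α p : ℝ} (ha : 0 < a) (hα : 0 < α) (hα1 : α < 1) (hp : 0 < p)
    {l : Filter ℝ} (hl : ∀ᶠ x in l, x ≠ Real.log p)
    (hlim : Tendsto (fun x => Real.exp (α * x) / |Real.exp x - p|) l (𝓝 0)) :
    Tendsto (fun x : ℝ => ∫ y : ℝ in 0..Real.pi, keyholeIntegrand a α p (x + y * Complex.I)) l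
      (𝓝 0) := by
  obtain ⟨C, hC, hb⟩ := exists_norm_keyholeIntegrand_le ha hα hα1 hp
  have hlim' : Tendsto (fun x => C * (Real.exp (α * x) / |Real.exp x - p|) * |Real.pi - 0|) l
      (𝓝 0) := by simpa using (hlim.const_mul C).mul_const |Real.pi - 0|
  refine squeeze_zero_norm' ?_ hlim'
  filter_upwards [hl] with x hx
  have hxp : Real.exp x - p ≠ 0 := fun h => hx (by rw [← sub_eq_zero.1 h, Real.log_exp])
  refine intervalIntegral.norm_integral_le_of_norm_le_const fun y hy => ?_
  rw [uIoc_of_le Real.pi_pos.le] at hy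
  have hne : (x + y * Complex.I : ℂ) ≠ (Real.log p : ℂ) := fun h => hx (by
    simpa using congrArg Complex.re h)
  refine (hb x y hy.1.le hy.2 hne).trans ?_
  rw [mul_div_assoc]
  have : |Real.exp x - p| ≤ ‖Complex.exp (x + y * Complex.I) - p‖ := by
    have h := abs_norm_sub_norm_le (Complex.exp (x + y * Complex.I)) (p : ℂ)
    rwa [Complex.norm_exp, Complex.norm_real, Real.norm_of_nonneg hp.le,
      show (x + y * Complex.I : ℂ).re = x by simp] at h
  have : 0 < |Real.exp x - p| := abs_pos.2 hxp
  gcongr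

theorem tendsto_exp_mul_div_atBot {α p : ℝ} (hα : 0 < α) (hp : 0 < p) :
    Tendsto (fun x => Real.exp (α * x) / |Real.exp x - p|) atBot (𝓝 0) := by
  have h1 : Tendsto (fun x => Real.exp (α * x)) atBot (𝓝 0) :=
    Real.tendsto_exp_atBot.comp (tendsto_id.const_mul_atBot hα)
  have h2 : Tendsto (fun x => |Real.exp x - p|) atBot (𝓝 |0 - p|) :=
    (Real.tendsto_exp_atBot.sub_const p).abs
  have h3 := h1.div h2 (by simpa using hp.ne')
  rwa [zero_div] at h3

theorem tendsto_exp_mul_div_atTop {α p : ℝ} (hα1 : α < 1) :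
    Tendsto (fun x => Real.exp (α * x) / |Real.exp x - p|) atTop (𝓝 0) := by
  have h1 : Tendsto (fun x => Real.exp ((α - 1) * x)) atTop (𝓝 0) :=
    Real.tendsto_exp_atBot.comp (tendsto_id.const_mul_atTop_of_neg (sub_neg.2 hα1))
  have h2 : Tendsto (fun x => |1 - p * Real.exp (-x)|) atTop (𝓝 |1 - p * 0|) :=
    ((Real.tendsto_exp_neg_atTop_nhds_zero.const_mul p).const_sub 1).abs
  have h3 := h1.div h2 (by simp)
  simp only [zero_div] at h3
  refine h3.congr fun x => ?_
  have e : Real.exp x - p = Real.exp x * (1 - p * Real.exp (-x)) := by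
    rw [mul_sub, mul_one, mul_left_comm, ← Real.exp_add]; simp
  simp only [Pi.div_apply]
  rw [e, abs_mul, Real.abs_exp, sub_mul, one_mul, Real.exp_sub, div_div]

theorem integrable_keyholeIntegrand_top {a α p : ℝ} (ha : 0 < a) (hα : 0 < α) (hα1 : α < 1)
    (hp : 0 < p) : Integrable fun x : ℝ => keyholeIntegrand a α p (x + Real.pi * Complex.I) := by
  obtain ⟨C, hC, hb⟩ := exists_norm_keyholeIntegrand_le ha hα hα1 hp
  refine ((integrable_exp_mul_div_add_exp hα hα1 hp).const_mul C).mono' ?_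
    (Eventually.of_forall fun x => ?_)
  · refine Continuous.aestronglyMeasurable ?_
    refine (differentiableOn_keyholeIntegrand ha hp).continuousOn.comp_continuous (by fun_prop)
      fun x => mem_keyholeStrip hα hα1 ?_ ?_ <;> simp [Real.pi_pos.le]
  · have hne : (x + Real.pi * Complex.I : ℂ) ≠ (Real.log p : ℂ) := fun h =>
      Real.pi_ne_zero (by simpa using congrArg Complex.im h)
    refine (hb x Real.pi Real.pi_pos.le le_rfl hne).trans_eq ?_
    have : Complex.exp (x + Real.pi * Complex.I) - p = ((-(p + Real.exp x) : ℝ) : ℂ) := by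
      rw [Complex.exp_add, Complex.exp_pi_mul_I]; push_cast; ring
    rw [this, Complex.norm_real, norm_neg, Real.norm_of_nonneg (by positivity), mul_div_assoc]

theorem im_integral_keyholeIntegrand_top {a α p : ℝ} (ha : 0 < a) (hα : 0 < α) (hα1 : α < 1)
    (hp : 0 < p) : (∫ x : ℝ, keyholeIntegrand a α p (x + Real.pi * Complex.I)).im = 0 := by
  have htop := intervalIntegral_tendsto_integral (integrable_keyholeIntegrand_top ha hα hα1 hp)
    tendsto_neg_atTop_atBot tendsto_id
  have hR := tendsto_integral_side ha hα hα1 hp (eventually_ne_atTop _)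
    (tendsto_exp_mul_div_atTop hα1)
  have hL := (tendsto_integral_side ha hα hα1 hp (eventually_ne_atBot _)
    (tendsto_exp_mul_div_atBot hα hp)).comp tendsto_neg_atTop_atBot
  have hside := (hR.const_mul Complex.I).sub (hL.const_mul Complex.I)
  have hrect : ∀ R : ℝ, (∫ x : ℝ in (-R)..R, keyholeIntegrand a α p (x + Real.pi * Complex.I)).im =
      (Complex.I * (∫ y : ℝ in 0..Real.pi, keyholeIntegrand a α p (R + y * Complex.I)) -
        Complex.I * (∫ y : ℝ in 0..Real.pi,
          keyholeIntegrand a α p ((-R : ℝ) + y * Complex.I))).im := by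
    intro R
    -- Cauchy's theorem on [-R, R] × [0, π]; in imaginary parts the lower edge drops out for every
    -- R, and the vertical sides vanish as R → ∞.
    have h := Complex.integral_boundary_rect_eq_zero_of_differentiableOn (keyholeIntegrand a α p)
      (-R : ℝ) (R + Real.pi * Complex.I) ((differentiableOn_keyholeIntegrand ha hp).mono
        fun w hw => by
          have him := hw.2
          simp only [Complex.ofReal_im, Complex.add_im, Complex.mul_im, Complex.ofReal_re,
            Complex.I_re, Complex.I_im, mul_zero, mul_one, zero_add, add_zero, mem_preimage,
            uIcc_of_le Real.pi_pos.le] at him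
          exact mem_keyholeStrip hα hα1 him.1 him.2)
    have h' := congrArg Complex.im h
    simp only [Complex.ofReal_im, Complex.add_im, Complex.mul_im, Complex.ofReal_re,
      Complex.add_re, Complex.mul_re, Complex.I_re, Complex.I_im, mul_zero, mul_one, zero_add,
      add_zero, sub_zero, Complex.sub_im, smul_eq_mul, Complex.ofReal_zero, zero_mul,
      Complex.zero_im, im_integral_keyholeIntegrand_real hp R] at h' ⊢
    linarith
  have h1 := (Complex.continuous_im.tendsto _).comp htop
  have h2 := (Complex.continuous_im.tendsto _).comp hside
  simp only [mul_zero, sub_zero, Complex.zero_im] at h2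
  refine tendsto_nhds_unique h1 (h2.congr fun R => ?_)
  simp only [Function.comp_apply]
  exact (hrect R).symm

theorem im_keyholeIntegrand_top {a α p : ℝ} (ha : 0 < a) (hα : 0 < α) (hα1 : α < 1)
    (hp : 0 < p) (t : ℝ) : (keyholeIntegrand a α p (t + Real.pi * Complex.I)).im =
      Real.sin (α * Real.pi) * (1 / (a + p ^ α) * (Real.exp (α * t) / (p + Real.exp t)) -
        a * Real.exp (α * t) /
          Complex.normSq (a + Complex.exp (α * (t + Real.pi * Complex.I))) /
          (p + Real.exp t)) := by
  have hne : (t + Real.pi * Complex.I : ℂ) ≠ (Real.log p : ℂ) := fun h =>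
    Real.pi_ne_zero (by simpa using congrArg Complex.im h)
  have hden : Complex.exp (t + Real.pi * Complex.I) - p = ((-(p + Real.exp t) : ℝ) : ℂ) := by
    rw [Complex.exp_add, Complex.exp_pi_mul_I]; push_cast; ring
  have hnz : (a : ℂ) + Complex.exp (α * (t + Real.pi * Complex.I)) ≠ 0 :=
    add_exp_ne_zero_of_mem_keyholeStrip ha
      (mem_keyholeStrip hα hα1 (by simp [Real.pi_pos.le]) (by simp))
  have him : (Complex.exp (α * (t + Real.pi * Complex.I))).im =
      Real.exp (α * t) * Real.sin (α * Real.pi) := by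
    rw [Complex.exp_im]; simp
  have hpt : 0 < p + Real.exp t := by positivity
  rw [keyholeIntegrand_eq hp hne, hden, Complex.div_ofReal_im, mul_sub, Complex.sub_im,
    Complex.im_mul_ofReal, him]
  set ζ := Complex.exp (α * (t + Real.pi * Complex.I))
  -- In this form only the inverse has an imaginary part, which produces the density a · Im ζ / |a +
  -- ζ|².
  have e : ζ * (1 / ((a : ℂ) + ζ)) = 1 - a * ((a : ℂ) + ζ)⁻¹ := by
    field_simp; ring
  rw [e, Complex.sub_im, Complex.im_ofReal_mul, Complex.inv_im, Complex.add_im, him]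
  simp only [Complex.one_im, Complex.ofReal_im, zero_add]
  have : Complex.normSq ((a : ℂ) + ζ) ≠ 0 := (Complex.normSq_pos.2 hnz).ne'
  have : 0 < a + p ^ α := by positivity
  field_simp
  ring

theorem integrable_bOne_density {a α p : ℝ} (ha : 0 < a) (hα : 0 < α) (hα1 : α < 1)
    (hp : 0 < p) : Integrable fun t : ℝ => a * Real.exp (α * t) /
      Complex.normSq (a + Complex.exp (α * (t + Real.pi * Complex.I))) / (p + Real.exp t) := by
  have hc := abs_cos_mul_pi_lt_one hα hα1
  have hm : 0 < (1 - |Real.cos (α * Real.pi)|) * a ^ 2 := mul_pos (sub_pos.2 hc) (by positivity)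
  set m := (1 - |Real.cos (α * Real.pi)|) * a ^ 2
  refine ((integrable_exp_mul_div_add_exp hα hα1 hp).const_mul (a / m)).mono'
    (Measurable.aestronglyMeasurable (by fun_prop)) (Eventually.of_forall fun t => ?_)
  have h := le_normSq_add_exp ha hα hα1 t Real.pi_pos.le le_rfl
  have hn := hm.trans_le h
  rw [Real.norm_of_nonneg (by positivity), ← mul_div_assoc, div_mul_eq_mul_div]
  gcongr

/-- The vanishing imaginary part on the upper edge, divided by sin(απ) ≠ 0. -/
theorem integral_bOne_density {a α p : ℝ} (ha : 0 < a) (hα : 0 < α) (hα1 : α < 1)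
    (hp : 0 < p) : ∫ t : ℝ, a * Real.exp (α * t) /
      Complex.normSq (a + Complex.exp (α * (t + Real.pi * Complex.I))) / (p + Real.exp t) =
      1 / (a + p ^ α) * (p ^ (α - 1) * eulerIntegral α) := by
  have h := im_integral_keyholeIntegrand_top ha hα hα1 hp
  have h2 : (∫ x : ℝ, keyholeIntegrand a α p (x + Real.pi * Complex.I)).im =
      ∫ x : ℝ, (keyholeIntegrand a α p (x + Real.pi * Complex.I)).im :=
    (integral_im (integrable_keyholeIntegrand_top ha hα hα1 hp)).symm
  simp_rw [h2, im_keyholeIntegrand_top ha hα hα1 hp] at h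
  rw [integral_const_mul, integral_sub
    ((integrable_exp_mul_div_add_exp hα hα1 hp).const_mul _) (integrable_bOne_density ha hα hα1 hp),
    integral_const_mul, integral_exp_mul_div_add_exp _ hp] at h
  have hs : Real.sin (α * Real.pi) ≠ 0 :=
    (Real.sin_pos_of_pos_of_lt_pi (by have := Real.pi_pos; positivity)
      (by nlinarith [Real.pi_pos])).ne'
  have := (mul_eq_zero.1 h).resolve_left hs
  linarith

theorem isAdmissible_bOne {a c α : ℝ} (ha : 0 < a) (hc : 0 < c) (hα : 0 < α) (hα1 : α < 1) :
    IsAdmissible (bOne a c α) := by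
  have hK := eulerIntegral_pos hα hα1
  let w : ℝ → ℝ := fun t => a * Real.exp (α * t) /
    Complex.normSq (a + Complex.exp (α * (t + Real.pi * Complex.I)))
  have hw : ∀ t, 0 ≤ w t := fun t => div_nonneg (by positivity) (Complex.normSq_nonneg _)
  have h : IsAdmissible fun p => p * ∫ t, w t / (p + Real.exp t) :=
    isAdmissible_of_integral (by fun_prop) Real.measurable_exp hw
      (Eventually.of_forall Real.exp_pos) (integrable_bOne_density ha hα hα1 one_pos)
      fun _ _ => rfl
  refine (h.const_mul_comp_mul (div_pos hc hK).le one_pos).congr fun p hp => ?_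
  simp only [w, one_mul]
  rw [integral_bOne_density ha hα hα1 hp, bOne, Real.rpow_sub_one hp.ne']
  have : 0 < a + p ^ α := by positivity
  field_simp

/-! ### Limits and effective exponent of b₁ -/

theorem bOne_pos {a c α p : ℝ} (ha : 0 < a) (hc : 0 < c) (hp : 0 < p) : 0 < bOne a c α p := by
  unfold bOne; positivity

theorem bOne_lt {a c α p : ℝ} (ha : 0 < a) (hc : 0 < c) (hp : 0 < p) : bOne a c α p < c := by
  have : 0 < p ^ α := Real.rpow_pos_of_pos hp α
  rw [bOne, div_lt_iff₀ (by positivity)]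
  nlinarith

theorem le_bOne {a c α p : ℝ} (ha : 0 < a) (hc : 0 < c) (hα : 0 ≤ α) (hp : 1 ≤ p) :
    c / (a + 1) ≤ bOne a c α p := by
  have : 1 ≤ p ^ α := Real.one_le_rpow hp hα
  rw [bOne, div_le_div_iff₀ (by positivity) (by positivity)]
  nlinarith [mul_nonneg (mul_pos hc ha).le (sub_nonneg.2 this)]

theorem tendsto_bOne_div_atTop {a c α : ℝ} (ha : 0 < a) (hc : 0 < c) :
    Tendsto (fun p : ℝ => bOne a c α p / p) atTop (𝓝 0) := by
  refine tendsto_bdd_div_atTop_nhds_zero (b := 0) (B := c) ?_ ?_ tendsto_id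
  · filter_upwards [eventually_gt_atTop 0] with p hp using (bOne_pos ha hc hp).le
  · filter_upwards [eventually_gt_atTop 0] with p hp using (bOne_lt ha hc hp).le

theorem bOne_zero {a c α : ℝ} (hα : 0 < α) : bOne a c α 0 = 0 := by
  simp [bOne, Real.zero_rpow hα.ne']

theorem tendsto_bOne_zero {a c α : ℝ} (ha : 0 < a) (hα : 0 < α) :
    Tendsto (bOne a c α) (𝓝[>] 0) (𝓝 0) := by
  have h : ContinuousAt (bOne a c α) 0 := by
    have h1 : ContinuousAt (fun p : ℝ => p ^ α) 0 :=
      Real.continuousAt_rpow_const 0 α (Or.inr hα.le)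
    refine (h1.const_mul c).div (h1.const_add a) ?_
    simpa [Real.zero_rpow hα.ne'] using ha.ne'
  have h2 := h.tendsto
  rw [bOne_zero hα] at h2
  exact h2.mono_left nhdsWithin_le_nhds

/-- For p ≥ 1, log b₁ stays between two constants while log p → ∞. -/
theorem tendsto_effectiveExponent_bOne {a c α : ℝ} (ha : 0 < a) (hc : 0 < c) (hα : 0 ≤ α) :
    Tendsto (effectiveExponent (bOne a c α)) atTop (𝓝 0) := by
  refine tendsto_bdd_div_atTop_nhds_zero (b := Real.log (c / (a + 1))) (B := Real.log c) ?_ ?_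
    Real.tendsto_log_atTop
  · filter_upwards [eventually_ge_atTop 1] with p hp
    exact Real.log_le_log (by positivity) (le_bOne ha hc hα hp)
  · filter_upwards [eventually_gt_atTop 0] with p hp
    exact Real.log_le_log (bOne_pos ha hc hp) (bOne_lt ha hc hp).le

theorem effectiveExponent_bOne_neg {a c α p : ℝ} (ha : 0 < a) (hc : 0 < c) (hc1 : c ≤ 1)
    (hp : 1 < p) : effectiveExponent (bOne a c α) p < 0 := by
  have hp0 : 0 < p := by linarith
  exact div_neg_of_neg_of_pos
    (Real.log_neg (bOne_pos ha hc hp0) ((bOne_lt ha hc hp0).trans_le hc1)) (Real.log_pos hp)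

/-! ### Limits of b₂ and of its effective exponent -/

theorem bTwo_zero {c τ α β : ℝ} (hβ : 0 < β) : bTwo c τ α β 0 = 0 := by
  simp [bTwo, Real.zero_rpow hβ.ne']

theorem tendsto_bTwo_zero {c τ α β : ℝ} (hβ : 0 < β) :
    Tendsto (bTwo c τ α β) (𝓝[>] 0) (𝓝 0) := by
  have h : ContinuousAt (bTwo c τ α β) 0 := by
    unfold bTwo
    refine (continuousAt_const.mul (ContinuousAt.rpow_const (by fun_prop) (Or.inl (by simp)))).mul
      (ContinuousAt.rpow_const (by fun_prop) (Or.inr hβ.le))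
  have h2 := h.tendsto
  rw [bTwo_zero hβ] at h2
  exact h2.mono_left nhdsWithin_le_nhds

theorem tendsto_bTwo_div_atTop {c τ α β : ℝ} (hτ : 0 < τ) (hα : α < 1) :
    Tendsto (fun p : ℝ => bTwo c τ α β p / p) atTop (𝓝 0) := by
  have h1 : Tendsto (fun p : ℝ => (p⁻¹ + τ) ^ (α - β)) atTop (𝓝 ((0 + τ) ^ (α - β))) :=
    (tendsto_inv_atTop_zero.add_const τ).rpow_const (Or.inl (by simpa using hτ.ne'))
  have h2 : Tendsto (fun p : ℝ => p ^ (α - 1)) atTop (𝓝 0) := by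
    simpa using tendsto_rpow_neg_atTop (sub_pos.2 hα)
  have h3 := ((h1.const_mul c).mul_const (τ ^ β)).mul h2
  rw [mul_zero] at h3
  refine h3.congr' ?_
  filter_upwards [eventually_gt_atTop 0] with p hp
  -- Factoring out p leaves a base tending to τ and exposes the decaying power p^(α-1).
  have e : 1 + τ * p = (p⁻¹ + τ) * p := by field_simp
  rw [bTwo, e, Real.mul_rpow (by positivity) hp.le, Real.mul_rpow hτ.le hp.le,
    show α - 1 = (α - β) + β - 1 by ring, Real.rpow_sub_one hp.ne', Real.rpow_add hp]
  ring

theorem isAdmissible_bTwo {c τ α β : ℝ} (hc : 0 < c) (hτ : 0 < τ) (hβ : 0 < β) (hβα : β ≤ α)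
    (hα : α < 1) : IsAdmissible (bTwo c τ α β) :=
  ((isAdmissible_one_add_rpow_mul_rpow hβ hβα hα).const_mul_comp_mul hc.le hτ).congr
    fun p _ => by rw [bTwo, mul_assoc]

theorem log_bTwo {c τ α β p : ℝ} (hc : 0 < c) (hτ : 0 < τ) (hp : 0 < p) :
    Real.log (bTwo c τ α β p) =
      Real.log c + (α - β) * Real.log (1 + τ * p) + β * (Real.log τ + Real.log p) := by
  have h1 : 0 < 1 + τ * p := by positivity
  have h2 : 0 < τ * p := by positivity
  rw [bTwo, Real.log_mul (by positivity) (by positivity), Real.log_mul (by positivity)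
    (by positivity), Real.log_rpow h1, Real.log_rpow h2, Real.log_mul hτ.ne' hp.ne']

theorem tendsto_effectiveExponent_bTwo_zero {c τ α β : ℝ} (hc : 0 < c) (hτ : 0 < τ) :
    Tendsto (effectiveExponent (bTwo c τ α β)) (𝓝[>] 0) (𝓝 β) := by
  have h1 : Tendsto (fun p : ℝ => Real.log c + (α - β) * Real.log (1 + τ * p) + β * Real.log τ)
      (𝓝[>] 0) (𝓝 (Real.log c + (α - β) * Real.log (1 + τ * 0) + β * Real.log τ)) := by
    refine Tendsto.mono_left (ContinuousAt.tendsto ?_) nhdsWithin_le_nhds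
    have : ContinuousAt (fun p : ℝ => Real.log (1 + τ * p)) 0 :=
      ContinuousAt.log (by fun_prop) (by simp)
    fun_prop
  have h2 := (h1.div_atBot Real.tendsto_log_nhdsGT_zero).add_const β
  rw [zero_add] at h2
  refine h2.congr' ?_
  filter_upwards [Ioo_mem_nhdsGT one_pos] with p hp
  have hl : Real.log p ≠ 0 := (Real.log_neg hp.1 hp.2).ne
  rw [effectiveExponent, log_bTwo hc hτ hp.1]
  field_simp
  ring

theorem tendsto_effectiveExponent_bTwo_atTop {c τ α β : ℝ} (hc : 0 < c) (hτ : 0 < τ) :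
    Tendsto (effectiveExponent (bTwo c τ α β)) atTop (𝓝 α) := by
  have h0 : Tendsto (fun p : ℝ => Real.log (p⁻¹ + τ)) atTop (𝓝 (Real.log (0 + τ))) :=
    (tendsto_inv_atTop_zero.add_const τ).log (by simpa using hτ.ne')
  have h1 := ((h0.const_mul (α - β)).const_add (Real.log c)).add_const (β * Real.log τ)
  have h2 := (h1.div_atTop Real.tendsto_log_atTop).add_const α
  rw [zero_add] at h2
  refine h2.congr' ?_
  filter_upwards [eventually_gt_atTop 1] with p hp
  have hp0 : 0 < p := by linarith
  have hl : Real.log p ≠ 0 := (Real.log_pos hp).ne'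
  have e : 1 + τ * p = (p⁻¹ + τ) * p := by field_simp
  rw [effectiveExponent, log_bTwo hc hτ hp0, e, Real.log_mul (by positivity) hp0.ne']
  field_simp
  ring

/-! ### Monotonicity of the effective exponent of b₂ -/

theorem strictConvexOn_log_bTwo_exp {c τ α β : ℝ} (hc : 0 < c) (hτ : 0 < τ) (hβα : β < α) :
    StrictConvexOn ℝ univ fun s => Real.log (bTwo c τ α β (Real.exp s)) := by
  have hd : ∀ s, HasDerivAt (fun s => Real.log (bTwo c τ α β (Real.exp s)))
      ((α - β) * (1 - 1 / (1 + τ * Real.exp s)) + β) s := fun s => by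
    have e : (fun s => Real.log (bTwo c τ α β (Real.exp s))) = fun s =>
        Real.log c + (α - β) * Real.log (1 + τ * Real.exp s) + β * (Real.log τ + s) := by
      ext s
      rw [log_bTwo hc hτ (Real.exp_pos s), Real.log_exp]
    have hpos : 0 < 1 + τ * Real.exp s := by positivity
    rw [e]
    refine ((((((Real.hasDerivAt_exp s).const_mul τ).const_add 1).log hpos.ne').const_mul
      (α - β)).const_add (Real.log c)).add (((hasDerivAt_id s).const_add (Real.log τ)).const_mul β)
      |>.congr_deriv ?_
    field_simp
    ring
  refine StrictMono.strictConvexOn_univ_of_deriv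
    (continuous_iff_continuousAt.2 fun s => (hd s).continuousAt) ?_
  intro s t hst
  rw [(hd s).deriv, (hd t).deriv]
  have hab : 0 < α - β := sub_pos.2 hβα
  gcongr

/-- h(s)/s is the secant slope from 0, strictly increasing, plus h(0)/s, which is nondecreasing on
each side of 0 because h(0) ≤ 0. The term h(0)/s is why s and t must have the same sign. -/
theorem div_lt_div_of_strictConvexOn {h : ℝ → ℝ} (hh : StrictConvexOn ℝ univ h) (h0 : h 0 ≤ 0)
    {s t : ℝ} (hst : s < t) (hpos : 0 < s * t) : h s / s < h t / t := by
  have hs : s ≠ 0 := left_ne_zero_of_mul hpos.ne'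
  have ht : t ≠ 0 := right_ne_zero_of_mul hpos.ne'
  have h1 := hh.secant_strict_mono (mem_univ 0) (mem_univ s) (mem_univ t) hs ht hst
  rw [sub_zero, sub_zero, sub_div, sub_div] at h1
  have h2 : h 0 / s ≤ h 0 / t := by
    rw [← sub_nonneg, show h 0 / t - h 0 / s = -h 0 * (t - s) / (s * t) by field_simp; ring]
    exact div_nonneg (mul_nonneg (by linarith) (by linarith)) hpos.le
  linarith

theorem effectiveExponent_eq_div {b : ℝ → ℝ} {p : ℝ} (hp : 0 < p) :
    effectiveExponent b p = Real.log (b (Real.exp (Real.log p))) / Real.log p := by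
  rw [effectiveExponent, Real.exp_log hp]

theorem bTwo_one_pos {c τ α β : ℝ} (hc : 0 < c) (hτ : 0 < τ) : 0 < bTwo c τ α β 1 := by
  unfold bTwo; positivity

theorem effectiveExponent_bTwo_lt {c τ α β p q : ℝ} (hc : 0 < c) (hτ : 0 < τ) (hβα : β < α)
    (h1 : bTwo c τ α β 1 ≤ 1) (hp : 0 < p) (hpq : p < q) (hpos : 0 < Real.log p * Real.log q) :
    effectiveExponent (bTwo c τ α β) p < effectiveExponent (bTwo c τ α β) q := by
  rw [effectiveExponent_eq_div hp, effectiveExponent_eq_div (hp.trans hpq)]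
  refine div_lt_div_of_strictConvexOn (strictConvexOn_log_bTwo_exp hc hτ hβα) ?_
    (Real.log_lt_log hp hpq) hpos
  rw [Real.exp_zero]
  exact Real.log_nonpos (bTwo_one_pos hc hτ).le h1

theorem strictMonoOn_effectiveExponent_bTwo {c τ α β : ℝ} (hc : 0 < c) (hτ : 0 < τ)
    (hβα : β < α) (h1 : bTwo c τ α β 1 = 1) :
    StrictMonoOn (effectiveExponent (bTwo c τ α β)) (Ioi 0 \ {1}) := by
  intro p hp q hq hpq
  have hp0 : 0 < p := hp.1
  have hq0 : 0 < q := hq.1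
  -- Here h(0) = log b₂(1) = 0, so the exponent is exactly the secant slope and p, q may lie on
  -- opposite sides of 1.
  have h := (strictConvexOn_log_bTwo_exp hc hτ hβα).secant_strict_mono (mem_univ 0)
    (mem_univ (Real.log p)) (mem_univ (Real.log q)) (Real.log_ne_zero_of_pos_of_ne_one hp0 hp.2)
    (Real.log_ne_zero_of_pos_of_ne_one hq0 hq.2) (Real.log_lt_log hp0 hpq)
  rw [effectiveExponent_eq_div hp0, effectiveExponent_eq_div hq0]
  simpa [h1] using h

theorem mainTheorem6 :
    (∀ a c α : ℝ, 0 < a → 0 < c → 0 ≤ α → α < 1 →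
      IsCompleteBernstein (bOne a c α) ∧
      Tendsto (fun p : ℝ => bOne a c α p / p) atTop (𝓝 0) ∧
      (0 < α →
        bOne a c α 0 = 0 ∧
        Tendsto (bOne a c α) (𝓝[>] 0) (𝓝 0) ∧
        IsAdmissible (bOne a c α)) ∧
      Tendsto (effectiveExponent (bOne a c α)) atTop (𝓝 0) ∧
      (c ≤ 1 → ∀ p : ℝ, 1 < p → effectiveExponent (bOne a c α) p < 0)) ∧
    (∀ c τ α β : ℝ, 0 < c → 0 < τ → 0 < β → β ≤ α → α < 1 →
      IsCompleteBernstein (bTwo c τ α β) ∧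
      bTwo c τ α β 0 = 0 ∧
      Tendsto (bTwo c τ α β) (𝓝[>] 0) (𝓝 0) ∧
      Tendsto (fun p : ℝ => bTwo c τ α β p / p) atTop (𝓝 0) ∧
      IsAdmissible (bTwo c τ α β) ∧
      Tendsto (effectiveExponent (bTwo c τ α β)) (𝓝[>] 0) (𝓝 β) ∧
      Tendsto (effectiveExponent (bTwo c τ α β)) atTop (𝓝 α) ∧
      (β < α → bTwo c τ α β 1 ≤ 1 →
        StrictMonoOn (effectiveExponent (bTwo c τ α β)) (Ioo 0 1) ∧
        StrictMonoOn (effectiveExponent (bTwo c τ α β)) (Ioi 1)) ∧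
      (β < α → bTwo c τ α β 1 = 1 →
        StrictMonoOn (effectiveExponent (bTwo c τ α β)) (Ioi 0 \ {1}))) := by
  refine ⟨fun a c α ha hc hα hα1 => ⟨?_, tendsto_bOne_div_atTop ha hc, fun hα0 =>
      ⟨bOne_zero hα0, tendsto_bOne_zero ha hα0, isAdmissible_bOne ha hc hα0 hα1⟩,
      tendsto_effectiveExponent_bOne ha hc hα, fun hc1 p hp =>
      effectiveExponent_bOne_neg ha hc hc1 hp⟩,
    fun c τ α β hc hτ hβ hβα hα => ⟨(isAdmissible_bTwo hc hτ hβ hβα hα).isCompleteBernstein,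
      bTwo_zero hβ, tendsto_bTwo_zero hβ, tendsto_bTwo_div_atTop hτ hα,
      isAdmissible_bTwo hc hτ hβ hβα hα, tendsto_effectiveExponent_bTwo_zero hc hτ,
      tendsto_effectiveExponent_bTwo_atTop hc hτ, fun hlt h1 => ⟨?_, ?_⟩, fun hlt h1 =>
      strictMonoOn_effectiveExponent_bTwo hc hτ hlt h1⟩⟩
  · rcases hα.eq_or_lt with rfl | hα0
    · exact isCompleteBernstein_const (k := c / (a + 1)) (by positivity) fun p _ => by simp [bOne]
    · exact (isAdmissible_bOne ha hc hα0 hα1).isCompleteBernstein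
  · intro p hp q hq hpq
    exact effectiveExponent_bTwo_lt hc hτ hlt h1 hp.1 hpq
      (mul_pos_of_neg_of_neg (Real.log_neg hp.1 hp.2) (Real.log_neg hq.1 hq.2))
  · intro p hp q hq hpq
    exact effectiveExponent_bTwo_lt hc hτ hlt h1 (one_pos.trans hp) hpq
      (mul_pos (Real.log_pos hp) (Real.log_pos hq))
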